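/- For $0<u\le 1$ let $\zeta(s,u)$ be the Hurwitz zeta function, i.e. the analytic continuation of $\sum_{n\ge 0}(n+u)^{-s}$ ($\operatorname{Re} s>1$), and let the generalised Stieltjes constants $\gamma_p(u)$, $p\ge 0$, be defined by its Laurent expansion about $s=1$, $$\zeta(s,u)=\frac{1}{s-1}+\sum_{p=0}^{\infty}\frac{(-1)^p}{p!}\,\gamma_p(u)\,(s-1)^p .$$ Write $\gamma_1=\gamma_1(1)$ for the first Stieltjes constant of the Riemann zeta function, $\gamma$ for Euler's constant, $\Gamma$ for the gamma function, $\log$ for the natural logarithm and $\log^2 x=(\log x)^2$. Then $$\gamma_1\left(\tfrac13\right)=\gamma_1-\frac32\,\gamma\log 3-\frac34\log^2 3-\frac{\pi}{4\sqrt3}\left[2\gamma-\log 3+8\log(2\pi)-12\log\Gamma\left(\tfrac13\right)\right]$$ and $$\gamma_1\left(\tfrac23\right)=\gamma_1-\frac32\,\gamma\log 3-\frac34\log^2 3+\frac{\pi}{4\sqrt3}\left[2\gamma-\log 3+8\log(2\pi)-12\log\Gamma\left(\tfrac13\right)\right].$$ -/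

import Mathlib

open Filter Topology

/-- The regular part `ζ(s, u) - 1 / (s - 1)` of the Hurwitz zeta function at `s = 1`, for
`0 < u ≤ 1`, the value at the removable singularity `s = 1` being the limit there.
(`HurwitzZeta.hurwitzZeta` is the analytic continuation of `∑ n, 1 / (n + u) ^ s`, with parameter
in `ℝ / ℤ`; its own value at `s = 1` is a conventional one and is not used.) -/
noncomputable def hurwitzZetaRegular (u : ℝ) : ℂ → ℂ :=
  Function.update (fun s : ℂ => HurwitzZeta.hurwitzZeta (u : UnitAddCircle) s - 1 / (s - 1)) 1
    (limUnder (𝓝[≠] (1 : ℂ))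
      (fun s : ℂ => HurwitzZeta.hurwitzZeta (u : UnitAddCircle) s - 1 / (s - 1)))

/-- The generalised Stieltjes constant `γ_p(u)`, for `0 < u ≤ 1`: the coefficients in
`ζ(s, u) = 1 / (s - 1) + ∑ p, (-1) ^ p / p! * γ_p(u) * (s - 1) ^ p`. -/
noncomputable def generalizedStieltjes (p : ℕ) (u : ℝ) : ℂ :=
  (-1) ^ p * iteratedDeriv p (hurwitzZetaRegular u) 1

/-- The Stieltjes constant `γ_p = γ_p(1)`, belonging to the Riemann zeta function. -/
noncomputable def stieltjes (p : ℕ) : ℂ :=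
  generalizedStieltjes p 1

/-- The limit in the definition of the regular part exists, and the regular part is entire. -/
theorem differentiable_hurwitzZetaRegular (u : ℝ) :
    Differentiable ℂ (hurwitzZetaRegular u) := by
  rw [← differentiableOn_univ]
  refine Complex.differentiableOn_update_limUnder_of_isLittleO univ_mem ?_ ?_
  · intro z hz
    have hz1 : z ≠ 1 := hz.2
    have h1 : DifferentiableAt ℂ (fun s : ℂ => 1 / (s - 1)) z :=
      (differentiableAt_const _).div (differentiableAt_id.sub_const 1) (sub_ne_zero.mpr hz1)
    exact ((HurwitzZeta.differentiableAt_hurwitzZeta _ hz1).sub h1).differentiableWithinAt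
  · have hne : ∀ᶠ z in 𝓝[≠] (1 : ℂ), z ≠ 1 := eventually_mem_nhdsWithin
    rw [Asymptotics.isLittleO_iff_tendsto']
    · have hres := HurwitzZeta.hurwitzZeta_residue_one (u : UnitAddCircle)
      set c : ℂ := HurwitzZeta.hurwitzZeta (u : UnitAddCircle) 1 - 1 / (1 - 1)
      have hz : Tendsto (fun z : ℂ => (z - 1) * c) (𝓝[≠] 1) (𝓝 0) := by
        have : Continuous (fun z : ℂ => (z - 1) * c) := by fun_prop
        simpa using (this.tendsto 1).mono_left nhdsWithin_le_nhds
      have := (hres.sub_const 1).sub hz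
      rw [sub_self, sub_zero] at this
      refine this.congr' ?_
      filter_upwards [hne] with z hz
      have : z - 1 ≠ 0 := sub_ne_zero.mpr hz
      field_simp
    · filter_upwards [hne] with z hz h
      exact absurd h (inv_ne_zero (sub_ne_zero.mpr hz))

/-- The Laurent expansion of the Hurwitz zeta function about `s = 1`. -/
theorem hasSum_generalizedStieltjes (u : ℝ) {s : ℂ} (hs : s ≠ 1) :
    HasSum (fun p : ℕ => (-1) ^ p / (p.factorial : ℂ) * generalizedStieltjes p u * (s - 1) ^ p)
      (HurwitzZeta.hurwitzZeta (u : UnitAddCircle) s - 1 / (s - 1)) := by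
  have h := Complex.hasSum_taylorSeries_of_entire (differentiable_hurwitzZetaRegular u) 1 s
  rw [hurwitzZetaRegular, Function.update_of_ne hs, ← hurwitzZetaRegular] at h
  refine h.congr_fun ?_
  intro p
  have h1 : ((-1 : ℂ) ^ p) * (-1) ^ p = 1 := by rw [← mul_pow]; simp
  simp only [generalizedStieltjes, smul_eq_mul]
  linear_combination (p.factorial : ℂ)⁻¹ * (s - 1) ^ p *
    iteratedDeriv p (hurwitzZetaRegular u) 1 * h1

/-! Up to sign, `γ₁(u)` is the derivative at `s = 1` of the regular part of `ζ(s, u)`, so it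
suffices to know the sum and the difference of these derivatives for `u = 1/3, 2/3`.

The sum comes from `ζ(s, 1/3) + ζ(s, 2/3) = (3 ^ s - 1) ζ(s)`, expanded at `s = 1`.

The difference `ζ(s, 1/3) - ζ(s, 2/3) = 2 D(s)` is entire. Modulo 3 the odd functions form a line,
so the finite Fourier transform only rescales `D`, and Hurwitz's formula becomes a functional
equation between `D(1 - s)` and `D(s)`. Its derivative at `s = 1` expresses `D'(1)` through `D(0)`
and `D'(0)`. The latter is the odd part of Lerch's formula (`deriv_hurwitzZetaOdd_zero`), and the
reflection formula removes `Γ(2/3)`. -/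

/-! ### Continuation of the odd Hurwitz zeta function past `s = 0` by a series -/

/-- Second-order mean value estimate for the power function `t ↦ t ^ (-s)` on `[m, M]`. -/
lemma norm_cpow_neg_sub_cpow_neg_sub_le {m M x y w : ℝ} (hm : 0 < m) (hx : x ∈ Set.Icc m M)
    (hy : y ∈ Set.Icc m M) (hw : w ∈ Set.Icc m M) {s : ℂ} (hs : -2 ≤ s.re) :
    ‖(x : ℂ) ^ (-s) - (y : ℂ) ^ (-s) - s * (y - x) * (w : ℂ) ^ (-s - 1)‖ ≤
      ‖s‖ * ‖s + 1‖ * m ^ (-s.re - 2) * (M - m) ^ 2 := by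
  have hder (r : ℂ) (t : ℝ) (ht : t ∈ Set.Icc m M) :
      HasDerivAt (fun t : ℝ => (t : ℂ) ^ r) (r * (t : ℂ) ^ (r - 1)) t := by
    have h := (hasDerivAt_id (t : ℂ)).cpow_const (c := r)
      (Complex.ofReal_mem_slitPlane.mpr (hm.trans_le ht.1))
    simpa using h.comp_ofReal
  have hdist {p q : ℝ} (hp : p ∈ Set.Icc m M) (hq : q ∈ Set.Icc m M) : ‖p - q‖ ≤ M - m := by
    rw [Real.norm_eq_abs, abs_le]
    constructor <;> linarith [hp.1, hp.2, hq.1, hq.2]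
  have hMm : 0 ≤ M - m := by linarith [hx.1, hx.2]
  have h1 (t : ℝ) (ht : t ∈ Set.Icc m M) :
      ‖(t : ℂ) ^ (-s - 1) - (w : ℂ) ^ (-s - 1)‖ ≤ ‖s + 1‖ * m ^ (-s.re - 2) * (M - m) := by
    refine ((convex_Icc m M).norm_image_sub_le_of_norm_hasDerivWithin_le
      (C := ‖s + 1‖ * m ^ (-s.re - 2))
      (fun v hv => (hder (-s - 1) v hv).hasDerivWithinAt) (fun v hv => ?_) hw ht).trans ?_
    · rw [norm_mul, Complex.norm_cpow_eq_rpow_re_of_pos (hm.trans_le hv.1),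
        show -s - 1 = -(s + 1) by ring, norm_neg]
      gcongr
      have : (-(s + 1) - 1).re = -s.re - 2 := by simp; ring
      rw [this]
      exact Real.rpow_le_rpow_of_nonpos hm hv.1 (by linarith)
    · gcongr
      exact hdist ht hw
  -- The added linear term cancels the derivative of `t ^ (-s)` at `w`; what remains is small by
  -- `h1`.
  have h2 := (convex_Icc m M).norm_image_sub_le_of_norm_hasDerivWithin_le
      (f := fun t : ℝ => (t : ℂ) ^ (-s) + s * (w : ℂ) ^ (-s - 1) * t)
      (f' := fun t : ℝ => -s * (t : ℂ) ^ (-s - 1) + s * (w : ℂ) ^ (-s - 1) * 1)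
      (C := ‖s‖ * (‖s + 1‖ * m ^ (-s.re - 2) * (M - m)))
      (fun v hv => ((hder (-s) v hv).add
        ((Complex.ofRealCLM.hasDerivAt).const_mul _)).hasDerivWithinAt) (fun v hv => ?_) hy hx
  · refine le_trans (le_of_eq ?_) (h2.trans ?_)
    · congr 1
      ring
    · rw [pow_two, ← mul_assoc, ← mul_assoc, ← mul_assoc]
      gcongr
      exact hdist hx hy
  · have : -s * (v : ℂ) ^ (-s - 1) + s * (w : ℂ) ^ (-s - 1) * 1 =
        -(s * ((v : ℂ) ^ (-s - 1) - (w : ℂ) ^ (-s - 1))) := by ring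
    rw [this, norm_neg, norm_mul]
    gcongr
    exact h1 v hv

/-- The terms of a series for `ζ(s, a) - ζ(s, 1 - a) - (1 - 2a) s ζ(s + 1)` that converges locally
uniformly on `Re s > -1`. -/
noncomputable def hurwitzOddTerm (a : ℝ) (n : ℕ) (s : ℂ) : ℂ :=
  ((n + a : ℝ) : ℂ) ^ (-s) - ((n + 1 - a : ℝ) : ℂ) ^ (-s)
    - s * ((n + 1 - a : ℝ) - (n + a : ℝ)) * ((n + 1 : ℝ) : ℂ) ^ (-s - 1)

lemma norm_hurwitzOddTerm_le {a : ℝ} (ha : a ∈ Set.Ioo (0 : ℝ) 1) (n : ℕ) {s : ℂ}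
    (hs : s ∈ Metric.ball (1 : ℂ) (3 / 2)) :
    ‖hurwitzOddTerm a n s‖ ≤
      5 / 2 * (7 / 2) * min a (1 - a) ^ (-5 : ℝ) * ((n + 1 : ℕ) : ℝ) ^ (-(3 / 2) : ℝ) := by
  set c := min a (1 - a) with hc
  obtain ⟨ha0, ha1⟩ := ha
  have hc0 : 0 < c := lt_min ha0 (by linarith)
  have hca : c ≤ a := min_le_left _ _
  have hca' : c ≤ 1 - a := min_le_right _ _
  rw [Metric.mem_ball, dist_eq_norm] at hs
  have hre := (Complex.abs_re_le_norm (s - 1)).trans_lt hs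
  rw [Complex.sub_re, Complex.one_re, abs_lt] at hre
  have hs1 : ‖s‖ ≤ 5 / 2 := by
    calc ‖s‖ = ‖(s - 1) + 1‖ := by ring_nf
      _ ≤ ‖s - 1‖ + ‖(1 : ℂ)‖ := norm_add_le _ _
      _ ≤ _ := by rw [norm_one]; linarith
  have hs2 : ‖s + 1‖ ≤ 7 / 2 := (norm_add_le _ _).trans (by rw [norm_one]; linarith)
  have hn : (0 : ℝ) ≤ n := n.cast_nonneg
  -- `[n + c, n + 1]` contains all three points `n + a`, `n + 1 - a` and `n + 1`.
  refine (norm_cpow_neg_sub_cpow_neg_sub_le (m := n + c) (M := n + 1) (by positivity)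
    ⟨by linarith, by linarith⟩ ⟨by linarith, by linarith⟩ ⟨by linarith, by linarith⟩
    (by linarith)).trans ?_
  -- On the ball `-1/2 < Re s < 5/2`, so the exponent lies between `-9/2` and `-3/2`: the upper end
  -- gives summability in `n`, and `-5` bounds the power of `c ≤ 1`.
  have h1 : ((n : ℝ) + c) ^ (-s.re - 2) ≤ c ^ (-5 : ℝ) * ((n + 1 : ℕ) : ℝ) ^ (-(3 / 2) : ℝ) := by
    calc ((n : ℝ) + c) ^ (-s.re - 2) ≤ (c * ((n + 1 : ℕ) : ℝ)) ^ (-s.re - 2) := by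
          refine Real.rpow_le_rpow_of_nonpos (by positivity) ?_ (by linarith)
          push_cast
          nlinarith
      _ = c ^ (-s.re - 2) * ((n + 1 : ℕ) : ℝ) ^ (-s.re - 2) :=
          Real.mul_rpow hc0.le (by positivity)
      _ ≤ _ := by
          refine mul_le_mul (Real.rpow_le_rpow_of_exponent_ge hc0 (by linarith) (by linarith))
            (Real.rpow_le_rpow_of_exponent_le (by simp) (by linarith)) (by positivity)
            (by positivity)
  have h2 : ((n : ℝ) + 1 - (n + c)) ^ 2 ≤ 1 := by
    have : (n : ℝ) + 1 - (n + c) = 1 - c := by ring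
    rw [this]
    nlinarith
  calc ‖s‖ * ‖s + 1‖ * ((n : ℝ) + c) ^ (-s.re - 2) * ((n : ℝ) + 1 - (n + c)) ^ 2
      ≤ 5 / 2 * (7 / 2) * (c ^ (-5 : ℝ) * ((n + 1 : ℕ) : ℝ) ^ (-(3 / 2) : ℝ)) * 1 := by gcongr
    _ = _ := by ring

lemma summable_hurwitzOddTerm_bound (C : ℝ) :
    Summable fun n : ℕ => C * ((n + 1 : ℕ) : ℝ) ^ (-(3 / 2) : ℝ) :=
  ((summable_nat_add_iff 1).mpr (Real.summable_nat_rpow.mpr (by norm_num))).mul_left C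

lemma hasDerivAt_hurwitzOddTerm {a : ℝ} (ha : a ∈ Set.Ioo (0 : ℝ) 1) (n : ℕ) (s : ℂ) :
    HasDerivAt (hurwitzOddTerm a n)
      (((n + a : ℝ) : ℂ) ^ (-s) * Complex.log (n + a : ℝ) * (-1)
        - ((n + 1 - a : ℝ) : ℂ) ^ (-s) * Complex.log (n + 1 - a : ℝ) * (-1)
        - (1 * ((n + 1 - a : ℝ) - (n + a : ℝ)) * ((n + 1 : ℝ) : ℂ) ^ (-s - 1)
          + s * ((n + 1 - a : ℝ) - (n + a : ℝ)) *
            (((n + 1 : ℝ) : ℂ) ^ (-s - 1) * Complex.log (n + 1 : ℝ) * (-1)))) s := by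
  obtain ⟨ha0, ha1⟩ := ha
  have hn : (0 : ℝ) ≤ n := n.cast_nonneg
  have h (x : ℝ) (hx : 0 < x) : ((x : ℝ) : ℂ) ≠ 0 := Complex.ofReal_ne_zero.mpr hx.ne'
  refine (((hasDerivAt_id s).neg.const_cpow (Or.inl (h _ (by linarith)))).sub
    ((hasDerivAt_id s).neg.const_cpow (Or.inl (h _ (by linarith))))).sub
    ((((hasDerivAt_id s).mul_const _)).mul
      (((hasDerivAt_id s).neg.sub_const 1).const_cpow (Or.inl (h _ (by linarith)))))

lemma hasSum_hurwitzOddTerm_of_one_lt_re {a : ℝ} (ha : a ∈ Set.Ioo (0 : ℝ) 1) {s : ℂ}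
    (hs : 1 < s.re) :
    HasSum (fun n => hurwitzOddTerm a n s)
      (2 * HurwitzZeta.hurwitzZetaOdd a s - (1 - 2 * a) * riemannZeta₁ (s + 1)) := by
  have h1 := (HurwitzZeta.hasSum_nat_hurwitzZetaOdd_of_mem_Icc ⟨ha.1.le, ha.2.le⟩ hs).mul_left 2
  have hs' : 1 < (s + 1).re := by simp; linarith
  have h2 : HasSum (fun n : ℕ => 1 / ((n : ℂ) + 1) ^ (s + 1)) (riemannZeta (s + 1)) := by
    rw [zeta_eq_tsum_one_div_nat_add_one_cpow hs']
    have := (summable_nat_add_iff 1).mpr (Complex.summable_one_div_nat_cpow.mpr hs')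
    exact (by simpa using this : Summable _).hasSum
  have hs0 : s ≠ 0 := by rintro rfl; simp at hs; linarith
  have hz : riemannZeta₁ (s + 1) = s * riemannZeta (s + 1) := by
    rw [riemannZeta_eq_inv_sub_mul (by simpa using hs0)]
    field_simp
    simp [hs0]
  rw [hz]
  refine (h1.sub ((h2.mul_left s).mul_left (1 - 2 * (a : ℂ)))).congr_fun fun n => ?_
  rw [hurwitzOddTerm, show -s - 1 = -(s + 1) by ring]
  simp only [Complex.cpow_neg]
  push_cast
  ring

/-- Both sides are analytic on the ball and agree near `2`, where the Dirichlet series converge. The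
ball also contains `0`, where the series is needed. -/
lemma tsum_hurwitzOddTerm {a : ℝ} (ha : a ∈ Set.Ioo (0 : ℝ) 1) {s : ℂ}
    (hs : s ∈ Metric.ball (1 : ℂ) (3 / 2)) :
    ∑' n, hurwitzOddTerm a n s =
      2 * HurwitzZeta.hurwitzZetaOdd a s - (1 - 2 * a) * riemannZeta₁ (s + 1) := by
  have hL : DifferentiableOn ℂ (fun s => ∑' n, hurwitzOddTerm a n s)
      (Metric.ball (1 : ℂ) (3 / 2)) :=
    Complex.differentiableOn_tsum_of_summable_norm (summable_hurwitzOddTerm_bound _)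
      (fun n s _ => (hasDerivAt_hurwitzOddTerm ha n s).differentiableAt.differentiableWithinAt)
      Metric.isOpen_ball (fun n s hs => norm_hurwitzOddTerm_le ha n hs)
  have hR : Differentiable ℂ (fun s => 2 * HurwitzZeta.hurwitzZetaOdd a s
      - (1 - 2 * (a : ℂ)) * riemannZeta₁ (s + 1)) :=
    ((HurwitzZeta.differentiable_hurwitzZetaOdd a).const_mul 2).sub
      ((differentiable_riemannZeta₁.comp (differentiable_id.add_const 1)).const_mul _)
  refine (hL.analyticOnNhd Metric.isOpen_ball).eqOn_of_preconnected_of_eventuallyEq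
    (hR.differentiableOn.analyticOnNhd Metric.isOpen_ball)
    (convex_ball _ _).isPreconnected (z₀ := 2) ?_ ?_ hs
  · rw [Metric.mem_ball, dist_eq_norm]
    norm_num
  · filter_upwards [(isOpen_lt continuous_const Complex.continuous_re).mem_nhds
      (show (1 : ℝ) < (2 : ℂ).re by simp)] with z hz
    exact (hasSum_hurwitzOddTerm_of_one_lt_re ha hz).tsum_eq

/-- Every term of the series vanishes at `s = 0`, and `riemannZeta₁ 1 = 1`. -/
lemma hurwitzZetaOdd_zero_right {a : ℝ} (ha : a ∈ Set.Ioo (0 : ℝ) 1) :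
    HurwitzZeta.hurwitzZetaOdd a 0 = (1 - 2 * a) / 2 := by
  have h := tsum_hurwitzOddTerm ha (s := 0) (by rw [Metric.mem_ball, dist_eq_norm]; norm_num)
  simp [hurwitzOddTerm] at h
  linear_combination -h / 2

/-! ### The odd part of Lerch's formula -/

/-- The series for `log Γ(a) - log Γ(1 - a)` obtained from Euler's limit formula. -/
lemma hasSum_log_Gamma_sub_log_Gamma_one_sub {a : ℝ} (ha : a ∈ Set.Ioo (0 : ℝ) 1) {S : ℝ}
    (hS : HasSum (fun n : ℕ => Real.log (n + 1 - a) - Real.log (n + a)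
      - (1 - 2 * a) / (n + 1)) S) :
    S = Real.log (Real.Gamma a) - Real.log (Real.Gamma (1 - a))
      - (1 - 2 * a) * Real.eulerMascheroniConstant := by
  -- `logGammaSeq x n` sums `n + 1` logarithms while `harmonic n` has `n` terms; the shift matches
  -- the former, and `h5` disposes of the extra `1 / (n + 1)`.
  have h1 := hS.tendsto_sum_nat.comp (tendsto_add_atTop_nat 1)
  have h2 := Real.BohrMollerup.tendsto_log_gamma ha.1
  have h3 := Real.BohrMollerup.tendsto_log_gamma (x := 1 - a) (by linarith [ha.2])
  have h4 := Real.tendsto_harmonic_sub_log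
  have h5 : Tendsto (fun n : ℕ => (1 - 2 * a) * (1 / ((n : ℝ) + 1))) atTop (𝓝 0) := by
    simpa using tendsto_one_div_add_atTop_nhds_zero_nat.const_mul (1 - 2 * a)
  have h6 := ((h2.sub h3).sub (h4.const_mul (1 - 2 * a))).sub h5
  rw [sub_zero] at h6
  refine tendsto_nhds_unique h1 (h6.congr fun n => ?_)
  simp only [Function.comp_apply, Real.BohrMollerup.logGammaSeq, Finset.sum_sub_distrib]
  have hh : ∑ i ∈ Finset.range (n + 1), (1 - 2 * a) / ((i : ℝ) + 1)
      = (1 - 2 * a) * (harmonic n + 1 / ((n : ℝ) + 1)) := by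
    rw [Finset.sum_range_succ, harmonic]
    push_cast
    rw [mul_add, Finset.mul_sum]
    simp only [div_eq_mul_inv, one_mul]
  rw [hh]
  have e1 : ∑ i ∈ Finset.range (n + 1), Real.log ((i : ℝ) + 1 - a) =
      ∑ i ∈ Finset.range (n + 1), Real.log (1 - a + i) :=
    Finset.sum_congr rfl fun i _ => by congr 1; ring
  have e2 : ∑ i ∈ Finset.range (n + 1), Real.log ((i : ℝ) + a) =
      ∑ i ∈ Finset.range (n + 1), Real.log (a + i) :=
    Finset.sum_congr rfl fun i _ => by congr 1; ring
  rw [e1, e2]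
  ring

/-- The odd part of Lerch's formula `ζ'(0, a) = log Γ(a) - log (2π) / 2`. -/
theorem deriv_hurwitzZetaOdd_zero {a : ℝ} (ha : a ∈ Set.Ioo (0 : ℝ) 1) :
    deriv (HurwitzZeta.hurwitzZetaOdd a) 0 =
      ((Real.log (Real.Gamma a) - Real.log (Real.Gamma (1 - a))) / 2 : ℝ) := by
  have h0 : (0 : ℂ) ∈ Metric.ball (1 : ℂ) (3 / 2) := by
    rw [Metric.mem_ball, dist_eq_norm]; norm_num
  have hsum := Complex.hasSum_deriv_of_summable_norm (F := hurwitzOddTerm a)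
    (summable_hurwitzOddTerm_bound _)
    (fun n s _ => (hasDerivAt_hurwitzOddTerm ha n s).differentiableAt.differentiableWithinAt)
    Metric.isOpen_ball (fun n s hs => norm_hurwitzOddTerm_le ha n hs) h0
  have hterm (n : ℕ) : deriv (hurwitzOddTerm a n) 0 =
      ((Real.log (n + 1 - a) - Real.log (n + a) - (1 - 2 * a) / (n + 1) : ℝ) : ℂ) := by
    have hn : (0 : ℝ) ≤ n := n.cast_nonneg
    rw [(hasDerivAt_hurwitzOddTerm ha n 0).deriv, ← Complex.ofReal_log (by linarith [ha.1]),
      ← Complex.ofReal_log (by linarith [ha.2]), neg_zero, zero_sub, Complex.cpow_neg_one]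
    push_cast
    simp
    ring
  have hd : deriv (fun s => ∑' n, hurwitzOddTerm a n s) 0 =
      2 * deriv (HurwitzZeta.hurwitzZetaOdd a) 0
        - (1 - 2 * a) * Real.eulerMascheroniConstant := by
    have he : (fun s => ∑' n, hurwitzOddTerm a n s) =ᶠ[𝓝 0]
        fun s => 2 * HurwitzZeta.hurwitzZetaOdd a s - (1 - 2 * (a : ℂ)) * riemannZeta₁ (s + 1) := by
      filter_upwards [Metric.isOpen_ball.mem_nhds h0] with s hs using tsum_hurwitzOddTerm ha hs
    rw [he.deriv_eq]
    have hz : HasDerivAt (fun s => riemannZeta₁ (s + 1)) Real.eulerMascheroniConstant (0 : ℂ) := by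
      have := (differentiable_riemannZeta₁ (0 + 1)).hasDerivAt
      rw [zero_add] at this
      rw [deriv_riemannZeta₁_one] at this
      exact HasDerivAt.comp_add_const 0 1 (by rwa [zero_add])
    exact (((HurwitzZeta.differentiable_hurwitzZetaOdd a 0).hasDerivAt.const_mul 2).sub
      (hz.const_mul _)).deriv
  simp only [hterm] at hsum
  rw [hd] at hsum
  have hre := (Complex.hasSum_re hsum)
  simp only [Complex.ofReal_re] at hre
  have hS := hasSum_log_Gamma_sub_log_Gamma_one_sub ha hre
  have hC := hsum.unique (Complex.hasSum_ofReal.mpr hre)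
  rw [hS] at hC
  push_cast at hC ⊢
  linear_combination hC / 2

/-! ### Regular parts at `s = 1` -/

lemma hurwitzZetaRegular_of_ne (u : ℝ) {s : ℂ} (hs : s ≠ 1) :
    hurwitzZetaRegular u s = HurwitzZeta.hurwitzZeta (u : UnitAddCircle) s - 1 / (s - 1) := by
  rw [hurwitzZetaRegular, Function.update_of_ne hs]

lemma hurwitzZetaRegular_one : hurwitzZetaRegular 1 = riemannZeta₀ := by
  have h1 : ((1 : ℝ) : UnitAddCircle) = 0 := AddCircle.coe_period 1
  refine Continuous.ext_on (dense_compl_singleton (1 : ℂ))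
    (differentiable_hurwitzZetaRegular 1).continuous differentiable_riemannZeta₀.continuous
    fun s hs => ?_
  rw [hurwitzZetaRegular_of_ne 1 hs, h1, HurwitzZeta.hurwitzZeta_zero,
    riemannZeta_eq_inv_sub_add hs]
  ring

lemma generalizedStieltjes_one_left (u : ℝ) :
    generalizedStieltjes 1 u = -deriv (hurwitzZetaRegular u) 1 := by
  rw [generalizedStieltjes, iteratedDeriv_one]
  ring

lemma stieltjes_one : stieltjes 1 = -deriv riemannZeta₀ 1 := by
  rw [stieltjes, generalizedStieltjes_one_left, hurwitzZetaRegular_one]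

/-! ### Finite Fourier analysis modulo 3 -/

lemma coe_two_thirds : ((2 / 3 : ℝ) : UnitAddCircle) = -((1 / 3 : ℝ) : UnitAddCircle) := by
  rw [eq_neg_iff_add_eq_zero, ← AddCircle.coe_add]
  norm_num

lemma toAddCircle_one_three : ZMod.toAddCircle (1 : ZMod 3) = ((1 / 3 : ℝ) : UnitAddCircle) := by
  simpa using ZMod.toAddCircle_natCast (N := 3) 1

lemma toAddCircle_two_three : ZMod.toAddCircle (2 : ZMod 3) = ((2 / 3 : ℝ) : UnitAddCircle) := by
  simpa using ZMod.toAddCircle_natCast (N := 3) 2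

/-- The distribution relation of the Hurwitz zeta function for the denominator `3`. -/
lemma hurwitzZeta_one_third_add_two_thirds {s : ℂ} (hs : s ≠ 1) :
    HurwitzZeta.hurwitzZeta ((1 / 3 : ℝ) : UnitAddCircle) s
      + HurwitzZeta.hurwitzZeta ((2 / 3 : ℝ) : UnitAddCircle) s = (3 ^ s - 1) * riemannZeta s := by
  -- The trivial additive character, whose L-function is `ζ` itself.
  have h := ZMod.LFunction_stdAddChar_eq_expZeta (0 : ZMod 3) s (Or.inr hs)
  have hsum (f : ZMod 3 → ℂ) : ∑ j, f j = f 0 + f 1 + f 2 := Fin.sum_univ_three f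
  simp only [zero_mul, AddChar.map_zero_eq_one, map_zero, HurwitzZeta.expZeta_zero,
    ZMod.LFunction, one_mul, hsum, toAddCircle_one_three, toAddCircle_two_three,
    HurwitzZeta.hurwitzZeta_zero, Complex.cpow_neg] at h
  have h3 : (3 : ℂ) ^ s ≠ 0 := by simp [Complex.cpow_eq_zero_iff]
  push_cast at h
  field_simp at h
  linear_combination h

lemma stdAddChar_one_three_sub_two :
    (ZMod.stdAddChar (1 : ZMod 3) : ℂ) - ZMod.stdAddChar (2 : ZMod 3) =
      Real.sqrt 3 * Complex.I := by
  have h1 : (ZMod.stdAddChar (1 : ZMod 3) : ℂ) = -1 / 2 + Real.sqrt 3 / 2 * Complex.I := by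
    have := ZMod.stdAddChar_coe (N := 3) 1
    rw [Int.cast_one] at this
    rw [this, show 2 * (Real.pi : ℂ) * Complex.I * (1 : ℤ) / (3 : ℕ)
      = ((Real.pi - Real.pi / 3 : ℝ) : ℂ) * Complex.I by push_cast; ring, Complex.exp_mul_I,
      ← Complex.ofReal_cos, ← Complex.ofReal_sin, Real.cos_pi_sub, Real.sin_pi_sub,
      Real.cos_pi_div_three, Real.sin_pi_div_three]
    push_cast
    ring
  have h2 : (ZMod.stdAddChar (2 : ZMod 3) : ℂ) = ZMod.stdAddChar (1 : ZMod 3) ^ 2 := by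
    rw [pow_two, ← AddChar.map_add_eq_mul]
    rfl
  have h3 : (Real.sqrt 3 : ℂ) ^ 2 = 3 := by
    rw [← Complex.ofReal_pow, Real.sq_sqrt (by norm_num)]; norm_num
  rw [h2, h1]
  linear_combination (-(Real.sqrt 3 : ℂ) ^ 2 / 4) * Complex.I_sq + h3 / 4

/-- The two nontrivial additive characters modulo 3 differ by `√3 i` times the odd function with
values `0, 1, -1`. -/
lemma sinZeta_one_third (s : ℂ) :
    HurwitzZeta.sinZeta ((1 / 3 : ℝ) : UnitAddCircle) s =
      Real.sqrt 3 * 3 ^ (-s) * HurwitzZeta.hurwitzZetaOdd ((1 / 3 : ℝ) : UnitAddCircle) s := by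
  have h1 := ZMod.LFunction_stdAddChar_eq_expZeta (1 : ZMod 3) s (Or.inl (by decide))
  have h2 := ZMod.LFunction_stdAddChar_eq_expZeta (2 : ZMod 3) s (Or.inl (by decide))
  have hsum (f : ZMod 3 → ℂ) : ∑ j, f j = f 0 + f 1 + f 2 := Fin.sum_univ_three f
  have e1 : (2 : ZMod 3) * 2 = 1 := rfl
  simp only [ZMod.LFunction, hsum, toAddCircle_one_three, toAddCircle_two_three, one_mul, mul_one,
    mul_zero, e1] at h1 h2
  rw [HurwitzZeta.sinZeta_eq, HurwitzZeta.hurwitzZetaOdd_eq, ← coe_two_thirds, ← h1, ← h2]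
  have := stdAddChar_one_three_sub_two
  push_cast
  field_simp
  linear_combination (HurwitzZeta.hurwitzZeta ((1 / 3 : ℝ) : UnitAddCircle) s -
    HurwitzZeta.hurwitzZeta ((2 / 3 : ℝ) : UnitAddCircle) s) * this

/-- The functional equation of `ζ(s, 1/3) - ζ(s, 2/3)`. -/
lemma hurwitzZetaOdd_one_third_one_sub {s : ℂ} (hs : ∀ n : ℕ, s ≠ -n) :
    HurwitzZeta.hurwitzZetaOdd ((1 / 3 : ℝ) : UnitAddCircle) (1 - s) =
      2 * (2 * Real.pi) ^ (-s) * Complex.Gamma s * Complex.sin (Real.pi * s / 2) *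
        (Real.sqrt 3 * 3 ^ (-s) *
          HurwitzZeta.hurwitzZetaOdd ((1 / 3 : ℝ) : UnitAddCircle) s) := by
  rw [HurwitzZeta.hurwitzZetaOdd_one_sub _ hs, sinZeta_one_third]

/-! ### The difference of the two constants -/

lemma deriv_hurwitzZetaRegular_one_third_sub :
    deriv (hurwitzZetaRegular (1 / 3)) 1 - deriv (hurwitzZetaRegular (2 / 3)) 1 =
      2 * deriv (HurwitzZeta.hurwitzZetaOdd ((1 / 3 : ℝ) : UnitAddCircle)) 1 := by
  have h : hurwitzZetaRegular (1 / 3) - hurwitzZetaRegular (2 / 3) =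
      fun s => 2 * HurwitzZeta.hurwitzZetaOdd ((1 / 3 : ℝ) : UnitAddCircle) s := by
    refine Continuous.ext_on (dense_compl_singleton (1 : ℂ))
      ((differentiable_hurwitzZetaRegular _).sub (differentiable_hurwitzZetaRegular _)).continuous
      ((HurwitzZeta.differentiable_hurwitzZetaOdd _).const_mul 2).continuous fun s hs => ?_
    rw [Pi.sub_apply, hurwitzZetaRegular_of_ne _ hs, hurwitzZetaRegular_of_ne _ hs,
      HurwitzZeta.hurwitzZetaOdd_eq, coe_two_thirds]
    ring
  rw [← deriv_sub (differentiable_hurwitzZetaRegular _ _) (differentiable_hurwitzZetaRegular _ _),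
    h, deriv_const_mul _ (HurwitzZeta.differentiable_hurwitzZetaOdd _ _)]

lemma hasDerivAt_const_cpow_neg {c : ℝ} (hc : 0 < c) (s : ℂ) :
    HasDerivAt (fun s : ℂ => (c : ℂ) ^ (-s)) (-(Real.log c) * (c : ℂ) ^ (-s)) s := by
  have h := (hasDerivAt_id s).neg.const_cpow (c := (c : ℂ))
    (Or.inl (Complex.ofReal_ne_zero.mpr hc.ne'))
  rw [← Complex.ofReal_log hc.le] at h
  exact h.congr_deriv (by simp; ring)

lemma deriv_hurwitzZetaOdd_one_third_one :
    deriv (HurwitzZeta.hurwitzZetaOdd ((1 / 3 : ℝ) : UnitAddCircle)) 1 =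
      ((Real.pi / (4 * Real.sqrt 3) * (2 * Real.eulerMascheroniConstant - Real.log 3
        + 8 * Real.log (2 * Real.pi) - 12 * Real.log (Real.Gamma (1 / 3))) : ℝ) : ℂ) := by
  have ha : (1 / 3 : ℝ) ∈ Set.Ioo (0 : ℝ) 1 := by norm_num
  set D := HurwitzZeta.hurwitzZetaOdd ((1 / 3 : ℝ) : UnitAddCircle) with hD
  have hdiff : Differentiable ℂ D := HurwitzZeta.differentiable_hurwitzZetaOdd _
  have hD0 : D 0 = 1 / 6 := by
    rw [hD, hurwitzZetaOdd_zero_right ha]; push_cast; norm_num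
  have hs3 : (0 : ℝ) < Real.sqrt 3 := by positivity
  have hG : Real.log (Real.Gamma (1 - 1 / 3)) =
      Real.log (2 * Real.pi) - Real.log 3 / 2 - Real.log (Real.Gamma (1 / 3)) := by
    have h := Real.Gamma_mul_Gamma_one_sub (1 / 3)
    have hp : Real.pi / Real.sin (Real.pi * (1 / 3)) = 2 * Real.pi / Real.sqrt 3 := by
      rw [mul_one_div, Real.sin_pi_div_three]; field_simp
    rw [hp] at h
    have hl := congrArg Real.log h
    rw [Real.log_mul (Real.Gamma_pos_of_pos (by norm_num)).ne'
      (Real.Gamma_pos_of_pos (by norm_num)).ne',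
      Real.log_div (by positivity) hs3.ne', Real.log_sqrt (by norm_num)] at hl
    linarith
  have hD0' : deriv D 0 = ((Real.log (Real.Gamma (1 / 3)) - Real.log (2 * Real.pi) / 2
      + Real.log 3 / 4 : ℝ) : ℂ) := by
    rw [hD, deriv_hurwitzZetaOdd_zero ha, hG]
    congr 1
    ring
  have hpi : (0 : ℝ) < 2 * Real.pi := by positivity
  -- The derivative is a multiple of `cos (π / 2)`, so the sine factor adds nothing below.
  have hsin : HasDerivAt (fun s : ℂ => Complex.sin (Real.pi * s / 2)) 0 1 := by
    have h := (((hasDerivAt_id (1 : ℂ)).const_mul (Real.pi : ℂ)).div_const 2).csin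
    refine h.congr_deriv ?_
    simp
  have hprod := ((((hasDerivAt_const_cpow_neg hpi 1).const_mul 2).mul
    Complex.hasDerivAt_Gamma_one).mul hsin).mul
      (((hasDerivAt_const_cpow_neg (c := 3) (by norm_num) 1).const_mul (Real.sqrt 3 : ℂ)).mul
        (hdiff 1).hasDerivAt)
  have hne : ∀ᶠ s : ℂ in 𝓝 1, ∀ n : ℕ, s ≠ -n := by
    filter_upwards [(isOpen_lt continuous_const Complex.continuous_re).mem_nhds
      (show (0 : ℝ) < (1 : ℂ).re by simp)] with s hs n hn
    have hs' : 0 < s.re := hs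
    rw [hn, Complex.neg_re, Complex.natCast_re] at hs'
    linarith [(n.cast_nonneg : (0 : ℝ) ≤ n)]
  have hlhs : HasDerivAt (fun s => D (1 - s)) (-deriv D 0) 1 := by
    have := (hdiff (1 - 1)).hasDerivAt.scomp 1 ((hasDerivAt_id (1 : ℂ)).const_sub 1)
    exact this.congr_deriv (by simp)
  have hEq : (fun s => D (1 - s)) =ᶠ[𝓝 1] fun s => 2 * ((2 * Real.pi : ℝ) : ℂ) ^ (-s) *
      Complex.Gamma s * Complex.sin (Real.pi * s / 2) *
        (Real.sqrt 3 * ((3 : ℝ) : ℂ) ^ (-s) * D s) := by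
    filter_upwards [hne] with s hs
    push_cast
    exact hurwitzZetaOdd_one_third_one_sub hs
  -- The functional equation is used twice at `s = 1`: its value gives `D 1` from `D 0`, its
  -- derivative then gives `deriv D 1`.
  have hval := hEq.eq_of_nhds
  have hder := hlhs.unique (hprod.congr_of_eventuallyEq hEq)
  have hsin1 : Complex.sin (Real.pi / 2) = 1 := Complex.sin_pi_div_two
  simp only [Pi.mul_apply, mul_one, sub_self, Complex.cpow_neg_one, Complex.Gamma_one, hsin1, hD0,
    hD0', mul_zero, add_zero] at hval hder
  have hpi0 : (Real.pi : ℂ) ≠ 0 := Complex.ofReal_ne_zero.mpr Real.pi_ne_zero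
  have hs30 : (Real.sqrt 3 : ℂ) ≠ 0 := Complex.ofReal_ne_zero.mpr hs3.ne'
  have hD1 : D 1 = Real.pi / (2 * Real.sqrt 3) := by
    push_cast at hval
    field_simp at hval ⊢
    linear_combination -hval / 3
  rw [hD1] at hder
  push_cast at hder ⊢
  field_simp at hder ⊢
  linear_combination -hder / 2

/-! ### The sum of the two constants -/

lemma deriv_hurwitzZetaRegular_one_third_add :
    deriv (hurwitzZetaRegular (1 / 3)) 1 + deriv (hurwitzZetaRegular (2 / 3)) 1 =
      2 * deriv riemannZeta₀ 1 +
        ((3 * Real.eulerMascheroniConstant * Real.log 3 + 3 / 2 * Real.log 3 ^ 2 : ℝ) : ℂ) := by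
  have hpow (s : ℂ) : HasDerivAt (fun s : ℂ => (3 : ℂ) ^ s) (3 ^ s * Real.log 3) s := by
    have h := (hasDerivAt_id s).const_cpow (c := (3 : ℂ)) (Or.inl (by norm_num))
    refine h.congr_deriv ?_
    rw [show (3 : ℂ) = (3 : ℝ) by norm_num, ← Complex.ofReal_log (by norm_num)]
    simp
  set G : ℂ → ℂ := fun s => hurwitzZetaRegular (1 / 3) s + hurwitzZetaRegular (2 / 3) s
    - (3 ^ s - 1) * riemannZeta₀ s with hGdef
  have hGd (s : ℂ) : HasDerivAt G (deriv (hurwitzZetaRegular (1 / 3)) s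
      + deriv (hurwitzZetaRegular (2 / 3)) s
      - (3 ^ s * Real.log 3 * riemannZeta₀ s + (3 ^ s - 1) * deriv riemannZeta₀ s)) s :=
    ((differentiable_hurwitzZetaRegular _ s).hasDerivAt.add
      (differentiable_hurwitzZetaRegular _ s).hasDerivAt).sub
      (((hpow s).sub_const 1).mul (differentiable_riemannZeta₀ s).hasDerivAt)
  have hGdiff : Differentiable ℂ G := fun s => (hGd s).differentiableAt
  have hG (s : ℂ) : (s - 1) * G s = 3 ^ s - 3 := by
    rcases eq_or_ne s 1 with rfl | hs
    -- At `s = 1` both sides vanish, so the identity holds everywhere and can be differentiated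
    -- twice there.
    · simp
    · have h := hurwitzZeta_one_third_add_two_thirds hs
      rw [riemannZeta_eq_inv_sub_add hs] at h
      have hs' : s - 1 ≠ 0 := sub_ne_zero.mpr hs
      simp only [hGdef, hurwitzZetaRegular_of_ne _ hs]
      have e : (s - 1) * (s - 1)⁻¹ = 1 := mul_inv_cancel₀ hs'
      rw [one_div (s - 1)]
      linear_combination (s - 1) * h + (3 ^ s - 3) * e
  have h1 (s : ℂ) : G s + (s - 1) * deriv G s = 3 ^ s * Real.log 3 := by
    have h := ((hasDerivAt_id s).sub_const 1).mul (hGdiff s).hasDerivAt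
    have h' := (hpow s).sub_const 3
    rw [← funext hG] at h'
    simpa using h.unique h'
  have h2 : 2 * deriv G 1 = 3 * Real.log 3 ^ 2 := by
    have hG' : HasDerivAt (deriv G) (deriv (deriv G) 1) 1 :=
      ((hGdiff.contDiff (n := 2)).differentiable_deriv_two 1).hasDerivAt
    have h := (hGdiff 1).hasDerivAt.add (((hasDerivAt_id (1 : ℂ)).sub_const 1).mul hG')
    have h' := (hpow 1).mul_const (Real.log 3 : ℂ)
    rw [← funext h1] at h'
    have := h.unique h'
    rw [Complex.cpow_one, id_eq] at this
    linear_combination this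
  rw [(hGd 1).deriv, riemannZeta₀_one, Complex.cpow_one] at h2
  push_cast
  linear_combination h2 / 2

theorem mainTheorem4 :
    generalizedStieltjes 1 (1 / 3) =
        stieltjes 1 +
          ((-(3 / 2) * Real.eulerMascheroniConstant * Real.log 3 - 3 / 4 * Real.log 3 ^ 2
            - Real.pi / (4 * Real.sqrt 3) *
              (2 * Real.eulerMascheroniConstant - Real.log 3 + 8 * Real.log (2 * Real.pi)
                - 12 * Real.log (Real.Gamma (1 / 3))) : ℝ) : ℂ) ∧
      generalizedStieltjes 1 (2 / 3) =
        stieltjes 1 +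
          ((-(3 / 2) * Real.eulerMascheroniConstant * Real.log 3 - 3 / 4 * Real.log 3 ^ 2
            + Real.pi / (4 * Real.sqrt 3) *
              (2 * Real.eulerMascheroniConstant - Real.log 3 + 8 * Real.log (2 * Real.pi)
                - 12 * Real.log (Real.Gamma (1 / 3))) : ℝ) : ℂ) := by
  have hadd := deriv_hurwitzZetaRegular_one_third_add
  have hsub := deriv_hurwitzZetaRegular_one_third_sub
  rw [deriv_hurwitzZetaOdd_one_third_one] at hsub
  rw [generalizedStieltjes_one_left, generalizedStieltjes_one_left, stieltjes_one]
  push_cast at hadd hsub ⊢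
  constructor
  · linear_combination -(hadd + hsub) / 2
  · linear_combination -(hadd - hsub) / 2
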